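/- Let $R$ be a commutative noetherian ring, let $I,J$ be ideals of $R$, and let $M$ be a finitely generated $R$-module. For an ideal $\mathfrak{a}$ let $\operatorname{depth}(\mathfrak{a},M)$ be the supremum of the lengths of $M$-regular sequences contained in $\mathfrak{a}$ if $\mathfrak{a}M\neq M$, and $\infty$ if $\mathfrak{a}M=M$. Let $\tilde W(I,J)$ be the set of ideals $\mathfrak{a}$ of $R$ such that $I^n\subseteq\mathfrak{a}+J$ for all $n\gg 1$, and put $$\operatorname{depth}(I,J,M)=\inf\{\operatorname{depth}(\mathfrak{a},M)\mid \mathfrak{a}\in\tilde W(I,J)\}.$$ For an $R$-module $X$ let $\Gamma_{\mathfrak{a}}(X)=\{x\in X\mid \mathfrak{a}^n x=0 \text{ for } n\gg1\}$ and $\Gamma_{I,J}(X)=\{x\in X\mid I^n x\subseteq Jx\text{ for } n\gg1\}$, and let $H^i_{\mathfrak{a}}$ and $H^i_{I,J}$ be the $i$-th right derived functors of $\Gamma_{\mathfrak{a}}$ and $\Gamma_{I,J}$. Let $\mathfrak{a}\in\tilde W(I,J)$ with $\mathfrak{a}M\neq M$. Then $t:=\operatorname{depth}(I,J,M)$ is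 finite, and the following statements are equivalent: 1. $\operatorname{Hom}_R(R/\mathfrak{a},H^t_{\mathfrak{a}}(M))\neq0$; 2. $\operatorname{Hom}_R(R/\mathfrak{a},H^t_{\mathfrak{a},J}(M))\neq0$; 3. $\operatorname{Ext}^t_R(R/\mathfrak{a},M)\neq0$; 4. $\operatorname{Hom}_R(R/\mathfrak{a},H^t_{I,J}(M))\neq0$; 5. $\operatorname{depth}(\mathfrak{a},M)=t$. -/

import Mathlib

open CategoryTheory

universe u

namespace PairDepth

section Modules

variable {R : Type u} [CommRing R]

/-- The `𝔞`-torsion submodule `Γ_𝔞(M) = ⋃ₙ (0 :_M 𝔞ⁿ)`. -/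
def torsion (𝔞 : Ideal R) (M : Type u) [AddCommGroup M] [Module R M] : Submodule R M where
  carrier := {x | ∃ n : ℕ, ∀ r ∈ 𝔞 ^ n, r • x = 0}
  zero_mem' := ⟨0, fun r _ => smul_zero r⟩
  add_mem' := by
    rintro x y ⟨n, hx⟩ ⟨m, hy⟩
    refine ⟨n + m, fun r hr => ?_⟩
    rw [smul_add, hx r (Ideal.pow_le_pow_right (Nat.le_add_right n m) hr),
      hy r (Ideal.pow_le_pow_right (Nat.le_add_left m n) hr), add_zero]
  smul_mem' := by
    rintro c x ⟨n, hx⟩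
    exact ⟨n, fun r hr => by rw [smul_comm, hx r hr, smul_zero]⟩

/-- `Iⁿ x ⊆ J x` holds iff `Iⁿ ⊆ Ann(x) + J`. -/
theorem smul_span_le_iff (K J : Ideal R) {M : Type u} [AddCommGroup M] [Module R M] (x : M) :
    K • Submodule.span R {x} ≤ J • Submodule.span R {x} ↔
      K ≤ Ideal.torsionOf R M x ⊔ J := by
  constructor
  · intro h r hr
    have h1 : r • x ∈ J • Submodule.span R {x} :=
      h (Submodule.smul_mem_smul hr (Submodule.mem_span_singleton_self x))
    obtain ⟨j, hj, hjx⟩ := Submodule.mem_smul_span_singleton.1 h1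
    refine Submodule.mem_sup.2 ⟨r - j, ?_, j, hj, sub_add_cancel r j⟩
    rw [Ideal.mem_torsionOf_iff, sub_smul, hjx, sub_self]
  · intro h
    refine Submodule.smul_le.2 fun r hr y hy => ?_
    obtain ⟨c, rfl⟩ := Submodule.mem_span_singleton.1 hy
    obtain ⟨s, hs, j, hj, rfl⟩ := Submodule.mem_sup.1 (h hr)
    rw [Ideal.mem_torsionOf_iff] at hs
    rw [smul_comm, add_smul, hs, zero_add]
    exact Submodule.smul_mem _ c
      (Submodule.smul_mem_smul hj (Submodule.mem_span_singleton_self x))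

/-- The `(I, J)`-torsion submodule
`Γ_{I,J}(M) = {x ∈ M | Iⁿ x ⊆ J x for all large n}`.  (If the inclusion holds for one `n`,
it holds for all larger ones.) -/
def pairTorsion (I J : Ideal R) (M : Type u) [AddCommGroup M] [Module R M] :
    Submodule R M where
  carrier := {x | ∃ n : ℕ, I ^ n • Submodule.span R {x} ≤ J • Submodule.span R {x}}
  zero_mem' := ⟨0, by simp⟩
  add_mem' := by
    rintro x y ⟨n, hx⟩ ⟨m, hy⟩
    rw [smul_span_le_iff] at hx hy
    refine ⟨n + m, (smul_span_le_iff _ _ _).2 ?_⟩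
    rw [pow_add]
    refine (Ideal.mul_mono hx hy).trans ?_
    rw [Ideal.sup_mul, Ideal.mul_sup]
    refine sup_le (sup_le ?_ ?_) ?_
    · refine le_trans (fun r hr => ?_) le_sup_left
      have h1 := Ideal.mul_le_right hr
      have h2 := Ideal.mul_le_left hr
      rw [Ideal.mem_torsionOf_iff] at h1 h2 ⊢
      rw [smul_add, h1, h2, add_zero]
    · exact Ideal.mul_le_right.trans le_sup_right
    · exact Ideal.mul_le_left.trans le_sup_right
  smul_mem' := by
    rintro c x ⟨n, hx⟩
    rw [smul_span_le_iff] at hx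
    refine ⟨n, (smul_span_le_iff _ _ _).2 (hx.trans (sup_le_sup_right (fun r hr => ?_) J))⟩
    rw [Ideal.mem_torsionOf_iff] at hr ⊢
    rw [smul_comm, hr, smul_zero]

/-- Linear maps preserve `𝔞`-torsion. -/
theorem map_mem_torsion (𝔞 : Ideal R) {M N : Type u} [AddCommGroup M] [Module R M]
    [AddCommGroup N] [Module R N] (f : M →ₗ[R] N) (x : M) (hx : x ∈ torsion 𝔞 M) :
    f x ∈ torsion 𝔞 N := by
  obtain ⟨n, hn⟩ := hx
  exact ⟨n, fun r hr => by rw [← map_smul, hn r hr, map_zero]⟩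

/-- Linear maps preserve `(I, J)`-torsion. -/
theorem map_mem_pairTorsion (I J : Ideal R) {M N : Type u} [AddCommGroup M] [Module R M]
    [AddCommGroup N] [Module R N] (f : M →ₗ[R] N) (x : M) (hx : x ∈ pairTorsion I J M) :
    f x ∈ pairTorsion I J N := by
  obtain ⟨n, hn⟩ := hx
  rw [smul_span_le_iff] at hn
  refine ⟨n, (smul_span_le_iff _ _ _).2 (hn.trans (sup_le_sup_right (fun r hr => ?_) J))⟩
  rw [Ideal.mem_torsionOf_iff] at hr ⊢
  rw [← map_smul, hr, map_zero]

end Modules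

noncomputable section Functors

variable {R : Type u} [CommRing R]

/-- The functor `X ↦ T X`, for submodules `T X ⊆ X` which are preserved by all linear maps;
on morphisms it is restriction. -/
def subfunctor (T : ∀ X : ModuleCat.{u} R, Submodule R X)
    (hT : ∀ (X Y : ModuleCat.{u} R) (f : X →ₗ[R] Y), ∀ x ∈ T X, f x ∈ T Y) :
    ModuleCat.{u} R ⥤ ModuleCat.{u} R where
  obj X := ModuleCat.of R (T X)
  map {X Y} f := ModuleCat.ofHom (f.hom.restrict (hT X Y f.hom))

instance subfunctor_additive (T : ∀ X : ModuleCat.{u} R, Submodule R X)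
    (hT : ∀ (X Y : ModuleCat.{u} R) (f : X →ₗ[R] Y), ∀ x ∈ T X, f x ∈ T Y) :
    (subfunctor T hT).Additive where
  map_add {_ _ _ _} := rfl

/-- The functor `Γ_𝔞`. -/
def Gamma (𝔞 : Ideal R) : ModuleCat.{u} R ⥤ ModuleCat.{u} R :=
  subfunctor (fun X => torsion 𝔞 X) (fun _ _ f => map_mem_torsion 𝔞 f)

instance Gamma_additive (𝔞 : Ideal R) : (Gamma 𝔞).Additive :=
  subfunctor_additive _ _

/-- The functor `Γ_{I,J}`. -/
def pairGamma (I J : Ideal R) : ModuleCat.{u} R ⥤ ModuleCat.{u} R :=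
  subfunctor (fun X => pairTorsion I J X) (fun _ _ f => map_mem_pairTorsion I J f)

instance pairGamma_additive (I J : Ideal R) : (pairGamma I J).Additive :=
  subfunctor_additive _ _

/-- The local cohomology module `H^i_𝔞(M)`: the `i`-th right derived functor of `Γ_𝔞`. -/
abbrev H (𝔞 : Ideal R) (i : ℕ) (M : Type u) [AddCommGroup M] [Module R M] :
    ModuleCat.{u} R :=
  ((Gamma 𝔞).rightDerived i).obj (ModuleCat.of R M)

/-- The local cohomology module `H^i_{I,J}(M)` with respect to the pair `(I, J)`: the `i`-th
right derived functor of `Γ_{I,J}`. -/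
abbrev pairH (I J : Ideal R) (i : ℕ) (M : Type u) [AddCommGroup M] [Module R M] :
    ModuleCat.{u} R :=
  ((pairGamma I J).rightDerived i).obj (ModuleCat.of R M)

end Functors

noncomputable section Depth

variable {R : Type u} [CommRing R]

/-- The set `W̃(I, J)` of ideals `𝔞` with `Iⁿ ⊆ 𝔞 + J` for all large `n`.  (If the inclusion
holds for one `n`, it holds for all larger ones.) -/
def tildeW (I J : Ideal R) : Set (Ideal R) :=
  {𝔞 | ∃ n : ℕ, I ^ n ≤ 𝔞 ⊔ J}

open Classical in
/-- `depth(𝔞, M)` of a finite module over a noetherian ring: the supremum of the lengths of the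
`M`-regular sequences of elements of `𝔞` if `𝔞M ≠ M`, and `∞` if `𝔞M = M`. -/
def depth (𝔞 : Ideal R) (M : Type u) [AddCommGroup M] [Module R M] : ℕ∞ :=
  if 𝔞 • (⊤ : Submodule R M) = ⊤ then ⊤
  else ⨆ rs ∈ {rs : List R | (∀ r ∈ rs, r ∈ 𝔞) ∧ RingTheory.Sequence.IsRegular M rs},
    (rs.length : ℕ∞)

/-- `depth(I, J, M) = inf {depth(𝔞, M) | 𝔞 ∈ W̃(I, J)}`. -/
def pairDepth (I J : Ideal R) (M : Type u) [AddCommGroup M] [Module R M] : ℕ∞ :=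
  ⨅ 𝔞 ∈ tildeW I J, depth 𝔞 M

end Depth

end PairDepth

/-! Each of `Γ_𝔞`, `Γ_{𝔞,J}`, `Γ_{I,J}` is the torsion functor of a filter `W` of ideals: `x` is
torsion iff `Ann x ∈ W`. The filters are `W̃(𝔞,0) ⊆ W̃(𝔞,J) ⊆ W̃(I,J)`. Since `t` is an infimum over
the largest one, every ideal in any of them has depth at least `t`, so by Rees `Ext^i(N, M) = 0` for
`i < t` and all finite `N` with `Ann N ∈ W` (`subsingleton_ext_of_le_depth`).

Under this vanishing, `Hom(R/𝔞, R^t Γ_W M)` and `Ext^t(R/𝔞, M)` are simultaneously nonzero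
(`nontrivial_hom_rightDerived_iff_ext`). Both are described by cocycles in an injective resolution,
and exactness one degree lower moves cocycles between them; no spectral sequence is needed. This
makes 1, 2 and 4 equivalent to 3. Rees' criterion gives 3 ↔ 5 (`nontrivial_ext_iff_depth_eq`), and
`exists_nontrivial_ext` makes the depth finite. -/

namespace PairDepth

/-! ### Depth and the vanishing of `Ext` -/

section DepthExt

open Abelian
open scoped Pointwise

variable {R : Type u} [CommRing R]

/-- `Ext` is annihilated by the annihilators of both arguments. -/
theorem subsingleton_ext_of_one_mem_sup {N M : ModuleCat.{u} R}
    (h : Module.annihilator R N ⊔ Module.annihilator R M = ⊤) (i : ℕ) :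
    Subsingleton (Ext.{u} N M i) := by
  refine subsingleton_of_forall_eq 0 fun x => ?_
  obtain ⟨r, hr, s, hs, hrs⟩ := Submodule.mem_sup.1 ((Ideal.eq_top_iff_one _).1 h)
  have hr0 : r • 𝟙 N = 0 := by
    ext y
    exact Module.mem_annihilator.1 hr y
  have hs0 : s • 𝟙 M = 0 := by
    ext y
    exact Module.mem_annihilator.1 hs y
  have h1 : r • x = (Ext.mk₀ (r • 𝟙 N)).comp x (zero_add i) := by simp [Ext.mk₀_smul]
  have h2 : s • x = x.comp (Ext.mk₀ (s • 𝟙 M)) (add_zero i) := by simp [Ext.mk₀_smul]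
  rw [← one_smul R x, ← hrs, add_smul, h1, h2, hr0, hs0]
  simp

variable [IsNoetherianRing R] {M : Type u} [AddCommGroup M] [Module R M] [Module.Finite R M]

/-- Below the depth of `M` on `𝔞`, the modules `Ext^i(N, M)` vanish for all finite modules `N`
annihilated by `𝔞`. -/
theorem subsingleton_ext_of_le_depth {𝔞 : Ideal R} {n : ℕ} (hn : (n : ℕ∞) ≤ depth 𝔞 M)
    (N : Type u) [AddCommGroup N] [Module R N] [Module.Finite R N]
    (hN : 𝔞 ≤ Module.annihilator R N) {i : ℕ} (hi : i < n) :
    Subsingleton (Ext.{u} (ModuleCat.of R N) (ModuleCat.of R M) i) := by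
  by_cases hM : 𝔞 • (⊤ : Submodule R M) = ⊤
  -- Nakayama: some `r ≡ 1` mod `𝔞` kills `M`, so the annihilators of `N` and `M` are comaximal.
  · obtain ⟨r, hr, hrM⟩ := Submodule.exists_sub_one_mem_and_smul_eq_zero_of_fg_of_le_smul 𝔞
      (⊤ : Submodule R M) Module.Finite.fg_top hM.ge
    refine subsingleton_ext_of_one_mem_sup ((Ideal.eq_top_iff_one _).2 ?_) i
    refine Submodule.mem_sup.2 ⟨-(r - 1), neg_mem (hN hr), r, ?_, by ring⟩
    exact Module.mem_annihilator.2 fun x => hrM x trivial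
  · rw [depth, if_neg hM] at hn
    have hlt : (i : ℕ∞) < ⨆ rs ∈ {rs : List R | (∀ r ∈ rs, r ∈ 𝔞) ∧
        RingTheory.Sequence.IsRegular M rs}, (rs.length : ℕ∞) :=
      lt_of_lt_of_le (Nat.cast_lt.2 hi) hn
    simp only [lt_iSup_iff] at hlt
    obtain ⟨rs, ⟨hmem, hreg⟩, hlen⟩ := hlt
    refine ModuleCat.subsingleton_ext_of_exists_isRegular 𝔞 (ModuleCat.of R N) ?_
      (ModuleCat.of R M) (lt_top_iff_ne_top.2 hM) rs hmem hreg i (Nat.cast_lt.1 hlen)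
    rw [Module.support_eq_zeroLocus]
    exact PrimeSpectrum.zeroLocus_anti_mono hN

/-- Rees' criterion applies because the support of `R/𝔞` is exactly `V(𝔞)`. -/
theorem le_depth_of_subsingleton_ext {𝔞 : Ideal R} (hM : 𝔞 • (⊤ : Submodule R M) ≠ ⊤) {n : ℕ}
    (h : ∀ i < n, Subsingleton (Ext.{u} (ModuleCat.of R (R ⧸ 𝔞)) (ModuleCat.of R M) i)) :
    (n : ℕ∞) ≤ depth 𝔞 M := by
  obtain ⟨rs, rfl, hmem, hreg⟩ := ModuleCat.exists_isRegular_of_exists_subsingleton_ext 𝔞 n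
    (ModuleCat.of R M) (lt_top_iff_ne_top.2 hM) (ModuleCat.of R (R ⧸ 𝔞))
    (by rw [Module.support_eq_zeroLocus, Ideal.annihilator_quotient]) h
  rw [depth, if_neg hM]
  exact le_iSup₂_of_le rs ⟨hmem, hreg⟩ le_rfl

/-- If `𝔞M ≠ M`, then some `Ext^i(R/𝔞, M)` does not vanish. -/
theorem exists_nontrivial_ext {𝔞 : Ideal R} (hM : 𝔞 • (⊤ : Submodule R M) ≠ ⊤) :
    ∃ i, Nontrivial (Ext.{u} (ModuleCat.of R (R ⧸ 𝔞)) (ModuleCat.of R M) i) := by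
  -- Noetherian induction on the kernel `K` of a surjection from `M` onto a quotient `M'`.
  suffices H : ∀ (K : Submodule R M) (M' : Type u) [AddCommGroup M'] [Module R M']
      [Module.Finite R M'] (f : M →ₗ[R] M'), Function.Surjective f → LinearMap.ker f = K →
      𝔞 • (⊤ : Submodule R M') ≠ ⊤ →
      ∃ i, Nontrivial (Ext.{u} (ModuleCat.of R (R ⧸ 𝔞)) (ModuleCat.of R M') i) from
    H _ M LinearMap.id Function.surjective_id rfl hM
  intro K
  induction K using WellFoundedGT.induction with
  | ind K ih =>
  intro M' _ _ _ f hf hK hM'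
  by_contra! hext
  have h0 : Subsingleton ((R ⧸ 𝔞) →ₗ[R] M') :=
    ((Ext.addEquiv₀.trans ModuleCat.homAddEquiv).subsingleton_congr).1 (hext 0)
  -- As `Hom(R/𝔞, M') = 0`, `𝔞` contains an `M'`-regular `x`; the induction continues with `M'/xM'`.
  obtain ⟨x, hx, hreg⟩ := IsSMulRegular.subsingleton_linearMap_iff.1 h0
  rw [Ideal.annihilator_quotient] at hx
  have hne : 𝔞 • (⊤ : Submodule R (QuotSMulTop x M')) ≠ ⊤ := by
    intro h
    apply hM'
    have h2 := congrArg (Submodule.comap (Submodule.mkQ (x • (⊤ : Submodule R M')))) h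
    simpa [Submodule.comap_smul_top_of_surjective 𝔞 _ (Submodule.mkQ_surjective _),
      Submodule.smul_mono_left ((Ideal.span_singleton_le_iff_mem 𝔞).mpr hx),
      ← Submodule.ideal_span_singleton_smul] using h2
  have hlt : K < LinearMap.ker (Submodule.mkQ (x • (⊤ : Submodule R M')) ∘ₗ f) := by
    refine lt_of_le_of_ne (fun y hy => ?_) fun h => ?_
    · rw [← hK, LinearMap.mem_ker] at hy
      simp [hy]
    · have hx0 : ∀ m : M', x • m = 0 := by
        intro m
        obtain ⟨y, rfl⟩ := hf m
        have : x • y ∈ LinearMap.ker (Submodule.mkQ (x • (⊤ : Submodule R M')) ∘ₗ f) := by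
          rw [LinearMap.mem_ker, LinearMap.comp_apply, map_smul, Submodule.mkQ_apply,
            Submodule.Quotient.mk_eq_zero]
          exact Submodule.smul_mem_pointwise_smul _ _ _ trivial
        rwa [← h, ← hK, LinearMap.mem_ker, map_smul] at this
      have : Subsingleton M' := subsingleton_of_forall_eq 0 fun m =>
        hreg (by simp [hx0 m])
      exact hM' (Subsingleton.elim _ _)
  obtain ⟨i, hi⟩ := ih _ hlt (QuotSMulTop x M') _
    ((Submodule.mkQ_surjective _).comp hf) rfl hne
  refine not_subsingleton_iff_nontrivial.2 hi ?_
  -- In the long exact sequence, `Ext^i(R/𝔞, M'/xM')` sits between `Ext^i` and `Ext^{i+1}` of `M'`.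
  have zero1 := AddCommGrpCat.isZero_of_iff_subsingleton.mpr (hext i)
  have zero2 := AddCommGrpCat.isZero_of_iff_subsingleton.mpr (hext (i + 1))
  exact AddCommGrpCat.subsingleton_of_isZero <| ShortComplex.Exact.isZero_of_both_zeros
    ((Ext.covariant_sequence_exact₃' (ModuleCat.of R (R ⧸ 𝔞))
      (IsSMulRegular.smulShortComplex_shortExact (M := ModuleCat.of R M') hreg)) i (i + 1) rfl)
    (zero1.eq_zero_of_src _) (zero2.eq_zero_of_tgt _)

theorem depth_lt_top {𝔞 : Ideal R} (hM : 𝔞 • (⊤ : Submodule R M) ≠ ⊤) : depth 𝔞 M < ⊤ := by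
  refine lt_top_iff_ne_top.2 fun h => ?_
  obtain ⟨i, hi⟩ := exists_nontrivial_ext hM
  exact not_subsingleton_iff_nontrivial.2 hi (subsingleton_ext_of_le_depth (n := i + 1)
    (h ▸ le_top) (R ⧸ 𝔞) Ideal.annihilator_quotient.ge i.lt_succ_self)

theorem nontrivial_ext_iff_depth_eq {𝔞 : Ideal R} (hM : 𝔞 • (⊤ : Submodule R M) ≠ ⊤) {t : ℕ}
    (ht : (t : ℕ∞) ≤ depth 𝔞 M) :
    Nontrivial (Ext.{u} (ModuleCat.of R (R ⧸ 𝔞)) (ModuleCat.of R M) t) ↔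
      depth 𝔞 M = t := by
  have vanish {n i : ℕ} (hn : (n : ℕ∞) ≤ depth 𝔞 M) (hi : i < n) :
      Subsingleton (Ext.{u} (ModuleCat.of R (R ⧸ 𝔞)) (ModuleCat.of R M) i) :=
    subsingleton_ext_of_le_depth hn (R ⧸ 𝔞) Ideal.annihilator_quotient.ge hi
  rw [← not_subsingleton_iff_nontrivial]
  constructor
  · intro h
    refine le_antisymm (not_lt.1 fun hlt => h ?_) ht
    exact vanish (n := t + 1) (by simpa using Order.add_one_le_of_lt hlt) t.lt_succ_self
  · intro h hs
    have : ((t + 1 : ℕ) : ℕ∞) ≤ depth 𝔞 M := le_depth_of_subsingleton_ext hM fun i hi => by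
      rcases Nat.lt_succ_iff_lt_or_eq.1 hi with hi | rfl
      exacts [vanish ht hi, hs]
    rw [h, Nat.cast_le] at this
    omega

end DepthExt

end PairDepth

namespace PairDepth

/-! ### Correcting cocycles by coboundaries -/

section Cocycles

variable {R : Type u} [CommRing R]

/-- A map into an injective module which vanishes on the kernel of `p` extends along `p`. -/
theorem exists_comp_eq_of_ker_le {X Y E : Type u} [AddCommGroup X] [Module R X] [AddCommGroup Y]
    [Module R Y] [AddCommGroup E] [Module R E] [Module.Injective R E] (p : X →ₗ[R] Y)
    (q : X →ₗ[R] E) (h : LinearMap.ker p ≤ LinearMap.ker q) :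
    ∃ g : Y →ₗ[R] E, g ∘ₗ p = q := by
  obtain ⟨g, hg⟩ := Module.Injective.out ((LinearMap.ker p).liftQ p le_rfl)
    (LinearMap.ker_eq_bot.1 (Submodule.ker_liftQ_eq_bot _ _ _ le_rfl))
    ((LinearMap.ker p).liftQ q h)
  exact ⟨g, LinearMap.ext fun x => by simpa using hg (Submodule.Quotient.mk x)⟩

/-- A family of ideals which is closed under finite intersections and larger ideals. -/
structure IsIdealFilter (W : Set (Ideal R)) : Prop where
  top_mem : ⊤ ∈ W
  inf_mem : ∀ {𝔟 𝔠}, 𝔟 ∈ W → 𝔠 ∈ W → 𝔟 ⊓ 𝔠 ∈ W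
  mem_of_le : ∀ {𝔟 𝔠}, 𝔟 ∈ W → 𝔟 ≤ 𝔠 → 𝔠 ∈ W

/-- Every cocycle `N → B` is a coboundary, for all finite modules `N` which are annihilated by
some ideal in `W`. -/
def ExactOn (W : Set (Ideal R)) {A B C : Type u} [AddCommGroup A] [Module R A] [AddCommGroup B]
    [Module R B] [AddCommGroup C] [Module R C] (d₀ : A →ₗ[R] B) (d₁ : B →ₗ[R] C) : Prop :=
  ∀ (N : Type u) [AddCommGroup N] [Module R N] [Module.Finite R N],
    Module.annihilator R N ∈ W → ∀ φ : N →ₗ[R] B, d₁ ∘ₗ φ = 0 → ∃ ψ : N →ₗ[R] A, d₀ ∘ₗ ψ = φ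

variable [IsNoetherianRing R] {W : Set (Ideal R)} (hW : IsIdealFilter W)
  {A B C : Type u} [AddCommGroup A] [Module R A] [AddCommGroup B] [Module R B] [AddCommGroup C]
  [Module R C] [Module.Injective R A]
  {d₀ : A →ₗ[R] B} {d₁ : B →ₗ[R] C} (hd : d₁ ∘ₗ d₀ = 0) (hex : ExactOn W d₀ d₁)

include hW hd hex

/-- A cocycle annihilated by `𝔞` which is the coboundary of a `W`-torsion element is the
coboundary of an element annihilated by `𝔞`. -/
theorem exists_torsionBy_of_coboundary {𝔞 : Ideal R} {y : B}
    (hy : Ideal.torsionOf R B y ∈ W) (hz : 𝔞 ≤ Ideal.torsionOf R C (d₁ y)) :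
    ∃ y' : B, 𝔞 ≤ Ideal.torsionOf R B y' ∧ d₁ y' = d₁ y := by
  -- The inclusion `𝔞y → B` is a cocycle because `𝔞` kills `d₁ y`. Write it as `d₀ ψ`, extend `ψ` to
  -- `B`, and subtract `d₀ (ψ' y)` from `y`.
  obtain ⟨ψ, hψ⟩ := hex (Submodule.map (LinearMap.toSpanSingleton R B y) 𝔞)
    (hW.mem_of_le hy fun r hr => Module.mem_annihilator.2 (by
      rintro ⟨_, s, -, rfl⟩
      have hr : r • y = 0 := hr
      exact Subtype.ext (by simp [smul_comm r s y, hr])))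
    (Submodule.subtype _) (LinearMap.ext (by
      rintro ⟨_, s, hs, rfl⟩
      simpa using hz hs))
  obtain ⟨ψ', hψ'⟩ := Module.Injective.out (Submodule.subtype _)
    (Submodule.injective_subtype _) ψ
  have h2 : d₁ (d₀ (ψ' y)) = 0 := LinearMap.congr_fun hd _
  refine ⟨y - d₀ (ψ' y), fun r hr => ?_, by simp [h2]⟩
  have hmem : r • y ∈ Submodule.map (LinearMap.toSpanSingleton R B y) 𝔞 := ⟨r, hr, by simp⟩
  have h3 := hψ' ⟨_, hmem⟩
  have h4 := LinearMap.congr_fun hψ ⟨_, hmem⟩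
  simp only [LinearMap.comp_apply, Submodule.subtype_apply] at h3 h4
  change r • (y - d₀ (ψ' y)) = 0
  rw [smul_sub, ← map_smul, ← map_smul, h3, h4, sub_self]

variable [Module.Injective R B]

/-- Let `p : X → R/𝔠` and `q : X → B` be such that `d₁ q` vanishes on `ker p`.  Then `d₁ q`
lifts over `p` to a coboundary `d₁ y` with `𝔠 y = 0`. -/
theorem exists_lift_of_cocycle {𝔠 : Ideal R} (h𝔠 : 𝔠 ∈ W) (X : Type u) [AddCommGroup X]
    [Module R X] [Module.Finite R X] (hX : 𝔠 ≤ Module.annihilator R X) (p : X →ₗ[R] R ⧸ 𝔠)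
    (q : X →ₗ[R] B) (hpq : ∀ x, p x = 0 → d₁ (q x) = 0) :
    ∃ y : B, 𝔠 ≤ Ideal.torsionOf R B y ∧
      ∀ (x : X) (r : R), p x = Ideal.Quotient.mk 𝔠 r → d₁ (q x) = r • d₁ y := by
  -- On `ker p` the map `q` is a cocycle, hence equals `d₀ ψ`. With `ψ` extended to `X`, `q - d₀ ψ'`
  -- vanishes on `ker p` and so factors as `g ∘ p`; the witness is `g 1`.
  obtain ⟨ψ, hψ⟩ := hex (LinearMap.ker p)
    (hW.mem_of_le h𝔠 fun r hr => Module.mem_annihilator.2 fun x =>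
      Subtype.ext (Module.mem_annihilator.1 (hX hr) x.1))
    (q ∘ₗ (LinearMap.ker p).subtype) (LinearMap.ext fun x => hpq x x.2)
  obtain ⟨ψ', hψ'⟩ := Module.Injective.out (LinearMap.ker p).subtype
    (Submodule.injective_subtype _) ψ
  obtain ⟨g, hg⟩ := exists_comp_eq_of_ker_le p (q - d₀ ∘ₗ ψ') fun x hx => by
    have h1 := LinearMap.congr_fun hψ ⟨x, hx⟩
    have h2 := hψ' ⟨x, hx⟩
    simp only [LinearMap.comp_apply, Submodule.subtype_apply] at h1 h2
    simp [h1, h2]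
  refine ⟨g (Ideal.Quotient.mk 𝔠 1), fun r hr => ?_, fun x r hx => ?_⟩
  · change r • g _ = 0
    have : r • (Ideal.Quotient.mk 𝔠 1) = 0 := by
      rw [← Ideal.Quotient.eq_zero_iff_mem] at hr
      rw [Algebra.smul_def, map_one, mul_one]
      exact hr
    rw [← map_smul, this, map_zero]
  · have h1 := congrArg d₁ (LinearMap.congr_fun hg x)
    have h2 : d₁ (d₀ (ψ' x)) = 0 := LinearMap.congr_fun hd _
    have h3 : p x = r • Ideal.Quotient.mk 𝔠 1 := by
      rw [hx, Algebra.smul_def, map_one, mul_one]; rfl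
    simp only [LinearMap.comp_apply, LinearMap.sub_apply, map_sub, h2, sub_zero] at h1
    rw [← h1, h3, map_smul, map_smul]

/-- A `W`-torsion element which is annihilated by `𝔞` modulo coboundaries of `W`-torsion elements
is cohomologous to an element annihilated by `𝔞`. -/
theorem exists_cohomologous_torsionBy {𝔞 : Ideal R} {z : C}
    (hz : Ideal.torsionOf R C z ∈ W)
    (h : ∀ r ∈ 𝔞, ∃ y : B, Ideal.torsionOf R B y ∈ W ∧ d₁ y = r • z) :
    ∃ y : B, Ideal.torsionOf R B y ∈ W ∧ 𝔞 ≤ Ideal.torsionOf R C (z - d₁ y) := by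
  classical
  obtain ⟨s, hs⟩ := IsNoetherian.noetherian 𝔞
  have hs𝔞 : ∀ r ∈ s, r ∈ 𝔞 := fun r hr => hs ▸ Ideal.subset_span hr
  choose! y hyW hy using h
  -- A single ideal of `W` killing `z` and the finitely many chosen `y r`.
  set 𝔠 : Ideal R := (s.inf fun r => Ideal.torsionOf R B (y r)) ⊓ Ideal.torsionOf R C z
  have h𝔠W : 𝔠 ∈ W := hW.inf_mem
    (Finset.inf_induction hW.top_mem (fun _ h₁ _ h₂ => hW.inf_mem h₁ h₂)
      fun r hr => hyW r (hs𝔞 r hr)) hz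
  have hcy : ∀ r ∈ s, ∀ c ∈ 𝔠, c • y r = 0 := fun r hr c hc =>
    (Finset.inf_le (f := fun r => Ideal.torsionOf R B (y r)) hr) hc.1
  have hcz : ∀ c ∈ 𝔠, c • z = 0 := fun c hc => hc.2
  let ζ : (R ⧸ 𝔠) →ₗ[R] C := Submodule.liftQ 𝔠 (LinearMap.toSpanSingleton R C z) fun c hc => by
    simpa using hcz c hc
  have hζ : ∀ r : R, ζ (Ideal.Quotient.mk 𝔠 r) = r • z := fun r => rfl
  -- The choice `r ↦ y r` need not be linear; the span `X` of the pairs `(r, y r)` replaces its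
  -- graph. On `X`, `d₁` of the second entry is the first entry times `z`.
  let X : Submodule R ((R ⧸ 𝔠) × B) :=
    Submodule.span R ((fun r => (Ideal.Quotient.mk 𝔠 r, y r)) '' (s : Set R))
  have hXfin : Module.Finite R X :=
    Module.Finite.iff_fg.2 (Submodule.fg_span (s.finite_toSet.image _))
  have hXeq : ∀ x ∈ X, d₁ x.2 = ζ x.1 := by
    have : X ≤ LinearMap.eqLocus (d₁ ∘ₗ LinearMap.snd R (R ⧸ 𝔠) B)
        (ζ ∘ₗ LinearMap.fst R (R ⧸ 𝔠) B) := by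
      refine Submodule.span_le.2 ?_
      rintro _ ⟨r, hr, rfl⟩
      exact hy r (hs𝔞 r hr)
    exact fun x hx => this hx
  have hXann : 𝔠 ≤ Module.annihilator R X := by
    refine fun c hc => (Submodule.mem_annihilator_span _ c).2 ?_
    rintro ⟨_, r, hr, rfl⟩
    refine Prod.ext ?_ (hcy r hr c hc)
    change Ideal.Quotient.mk 𝔠 (c * r) = 0
    exact Ideal.Quotient.eq_zero_iff_mem.2 (Ideal.mul_mem_right r 𝔠 hc)
  obtain ⟨y', hy', hlift⟩ := exists_lift_of_cocycle hW hd hex h𝔠W X hXann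
    (LinearMap.fst R (R ⧸ 𝔠) B ∘ₗ X.subtype) (LinearMap.snd R (R ⧸ 𝔠) B ∘ₗ X.subtype)
    fun x hx => by
      have := hXeq x x.2
      simp only [LinearMap.comp_apply, Submodule.subtype_apply, LinearMap.fst_apply,
        LinearMap.snd_apply] at hx ⊢
      rw [this, hx, map_zero]
  refine ⟨y', hW.mem_of_le h𝔠W hy', ?_⟩
  rw [← hs]
  refine Ideal.span_le.2 fun r hr => ?_
  have h1 := hlift ⟨_, Submodule.subset_span ⟨r, hr, rfl⟩⟩ r rfl
  change r • (z - d₁ y') = 0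
  rw [smul_sub, ← h1, ← hy r (hs𝔞 r hr)]
  exact sub_self _

end Cocycles

end PairDepth

namespace PairDepth

/-! ### Derived functors and `Ext` via injective resolutions -/

section Homology

open Abelian

variable {R : Type u} [CommRing R]

theorem nontrivial_quotient_hom_iff (𝔞 : Ideal R) (X : Type u) [AddCommGroup X] [Module R X] :
    Nontrivial ((R ⧸ 𝔞) →ₗ[R] X) ↔ ∃ x : X, 𝔞 ≤ Ideal.torsionOf R X x ∧ x ≠ 0 := by
  constructor
  · intro h
    obtain ⟨f, hf⟩ := exists_ne (0 : (R ⧸ 𝔞) →ₗ[R] X)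
    refine ⟨f (Submodule.Quotient.mk 1), fun r hr => ?_, fun h0 => hf ?_⟩
    · change r • f _ = 0
      rw [← map_smul, ← Submodule.Quotient.mk_smul, smul_eq_mul, mul_one,
        (Submodule.Quotient.mk_eq_zero 𝔞).2 hr, map_zero]
    · refine Submodule.linearMap_qext _ (LinearMap.ext_ring ?_)
      exact h0
  · rintro ⟨x, hx, hx0⟩
    refine ⟨⟨Submodule.liftQ 𝔞 (LinearMap.toSpanSingleton R X x) fun r hr => hx hr, 0,
      fun h => hx0 ?_⟩⟩
    exact (one_smul R x).symm.trans (LinearMap.congr_fun h (Submodule.Quotient.mk 1))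

/-- Nonzero maps from `R/𝔞` to the homology of a complex, in terms of cocycles. -/
theorem nontrivial_hom_homology_iff (𝔞 : Ideal R) (K : CochainComplex (ModuleCat.{u} R) ℕ)
    (t : ℕ) :
    Nontrivial ((R ⧸ 𝔞) →ₗ[R] K.homology t) ↔
      ∃ z : K.X t, K.d t ((ComplexShape.up ℕ).next t) z = 0 ∧
        (∀ r ∈ 𝔞, ∃ y, K.d ((ComplexShape.up ℕ).prev t) t y = r • z) ∧
        ¬ ∃ y, K.d ((ComplexShape.up ℕ).prev t) t y = z := by
  let S := K.sc t
  let e : K.homology t ≃ₗ[R] S.moduleCatLeftHomologyData.H := S.moduleCatHomologyIso.toLinearEquiv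
  rw [(e.congrRight (R := R) (M := R ⧸ 𝔞)).toEquiv.nontrivial_congr, nontrivial_quotient_hom_iff]
  have hrange : ∀ x : LinearMap.ker S.g.hom, x ∈ LinearMap.range S.moduleCatToCycles ↔
      ∃ y, S.f y = x := fun x =>
    ⟨fun ⟨y, hy⟩ => ⟨y, congrArg Subtype.val hy⟩, fun ⟨y, hy⟩ => ⟨y, Subtype.ext hy⟩⟩
  constructor
  · rintro ⟨x, hx, hx0⟩
    obtain ⟨z, rfl⟩ := Submodule.Quotient.mk_surjective _ x
    refine ⟨z.1, z.2, fun r hr => (hrange (r • z)).1 ?_, fun h => hx0 ?_⟩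
    · exact (Submodule.Quotient.mk_eq_zero _).1 (hx hr)
    · exact (Submodule.Quotient.mk_eq_zero _).2 ((hrange z).2 h)
  · rintro ⟨z, hz, hr, hz0⟩
    refine ⟨Submodule.Quotient.mk (⟨z, hz⟩ : LinearMap.ker S.g.hom), fun r hr' => ?_, fun h => ?_⟩
    · exact (Submodule.Quotient.mk_eq_zero _).2 
        ((hrange (r • (⟨z, hz⟩ : LinearMap.ker S.g.hom))).2 (hr r hr'))
    · exact hz0 ((hrange _).1 ((Submodule.Quotient.mk_eq_zero _).1 h))

/-- Vanishing of `Ext` in terms of cocycles in an injective resolution. -/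
theorem subsingleton_ext_iff (N : ModuleCat.{u} R) {M : ModuleCat.{u} R}
    (P : InjectiveResolution M) (t : ℕ) :
    Subsingleton (Ext.{u} N M t) ↔
      ∀ φ : N →ₗ[R] P.cocomplex.X t,
        (P.cocomplex.d t ((ComplexShape.up ℕ).next t)).hom ∘ₗ φ = 0 →
        ∃ ψ : N →ₗ[R] P.cocomplex.X ((ComplexShape.up ℕ).prev t),
          (P.cocomplex.d ((ComplexShape.up ℕ).prev t) t).hom ∘ₗ ψ = φ := by
  rw [CochainComplex.next]
  cases t with
  | zero =>
    -- Here `prev 0 = 0` and the incoming differential is zero, so the criterion says that every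
    -- cocycle `N → X⁰` vanishes; such cocycles are the maps `N → M`.
    have hshape : P.cocomplex.d ((ComplexShape.up ℕ).prev 0) 0 = 0 :=
      P.cocomplex.shape _ _ (by simp)
    rw [Ext.addEquiv₀.subsingleton_congr, hshape]
    constructor
    · intro h φ hφ
      refine ⟨0, ?_⟩
      have hφ' : ModuleCat.ofHom φ ≫ P.cocomplex.d 0 1 = 0 := ModuleCat.hom_ext hφ
      have h1 := P.isLimitKernelFork.fac (Limits.KernelFork.ofι _ hφ')
        Limits.WalkingParallelPair.zero
      have h2 : P.isLimitKernelFork.lift (Limits.KernelFork.ofι _ hφ') = 0 := h.elim _ _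
      rw [h2, Limits.zero_comp] at h1
      simpa using (congrArg ModuleCat.Hom.hom h1)
    · intro h
      refine subsingleton_of_forall_eq 0 fun f => ?_
      obtain ⟨ι, hι, hd⟩ : ∃ ι : M ⟶ P.cocomplex.X 0,
          Mono ι ∧ ι ≫ P.cocomplex.d 0 (0 + 1) = 0 :=
        ⟨P.ι.f 0, inferInstanceAs (Mono (P.ι.f 0)), P.ι_f_zero_comp_complex_d⟩
      obtain ⟨ψ, hψ⟩ := h (f ≫ ι).hom (by
        rw [← ModuleCat.hom_comp, Category.assoc, hd, Limits.comp_zero]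
        rfl)
      refine (cancel_mono ι).1 (ModuleCat.hom_ext (hψ.symm.trans ?_))
      rw [Limits.zero_comp]
      rfl
  | succ s =>
    rw [CochainComplex.prev_nat_succ]
    constructor
    · intro h φ hφ
      obtain ⟨g, hg⟩ := (P.extMk_eq_zero_iff (ModuleCat.ofHom φ) (s + 1 + 1) rfl
        (ModuleCat.hom_ext hφ) s rfl).1 (h.elim _ _)
      exact ⟨g.hom, by rw [← ModuleCat.hom_comp, hg]; rfl⟩
    · intro h
      refine subsingleton_of_forall_eq 0 fun x => ?_
      obtain ⟨f, hf, rfl⟩ := P.extMk_surjective x (s + 1 + 1) rfl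
      obtain ⟨ψ, hψ⟩ := h f.hom (by rw [← ModuleCat.hom_comp, hf]; rfl)
      exact (P.extMk_eq_zero_iff f (s + 1 + 1) rfl hf s rfl).2
        ⟨ModuleCat.ofHom ψ, ModuleCat.hom_ext hψ⟩

/-- Evaluation at `1` identifies maps from `R/𝔞` with elements killed by `𝔞`. -/
theorem nontrivial_ext_quotient_iff (𝔞 : Ideal R) {M : ModuleCat.{u} R}
    (P : InjectiveResolution M) (t : ℕ) :
    Nontrivial (Ext.{u} (ModuleCat.of R (R ⧸ 𝔞)) M t) ↔
      ∃ z : P.cocomplex.X t, P.cocomplex.d t ((ComplexShape.up ℕ).next t) z = 0 ∧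
        𝔞 ≤ Ideal.torsionOf R _ z ∧
        ¬ ∃ y, 𝔞 ≤ Ideal.torsionOf R _ y ∧
          P.cocomplex.d ((ComplexShape.up ℕ).prev t) t y = z := by
  let hom {X : Type u} [AddCommGroup X] [Module R X] (x : X) (hx : 𝔞 ≤ Ideal.torsionOf R X x) :
      (R ⧸ 𝔞) →ₗ[R] X := Submodule.liftQ 𝔞 (LinearMap.toSpanSingleton R X x) hx
  have hom_apply {X : Type u} [AddCommGroup X] [Module R X] (x : X)
      (hx : 𝔞 ≤ Ideal.torsionOf R X x) : hom x hx (Submodule.Quotient.mk 1) = x := one_smul R x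
  have ext {X : Type u} [AddCommGroup X] [Module R X] {f g : (R ⧸ 𝔞) →ₗ[R] X}
      (h : f (Submodule.Quotient.mk 1) = g (Submodule.Quotient.mk 1)) : f = g :=
    Submodule.linearMap_qext _ (LinearMap.ext_ring h)
  have tors {X : Type u} [AddCommGroup X] [Module R X] (f : (R ⧸ 𝔞) →ₗ[R] X) :
      𝔞 ≤ Ideal.torsionOf R X (f (Submodule.Quotient.mk 1)) := fun r hr => by
    change r • f _ = 0
    rw [← map_smul, ← Submodule.Quotient.mk_smul, smul_eq_mul, mul_one,
      (Submodule.Quotient.mk_eq_zero 𝔞).2 hr, map_zero]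
  rw [← not_subsingleton_iff_nontrivial, subsingleton_ext_iff _ P, not_iff_comm]
  push Not
  constructor
  · intro h φ hφ
    obtain ⟨y, hy, hyφ⟩ := h (φ (Submodule.Quotient.mk 1)) (LinearMap.congr_fun hφ _) (tors φ)
    refine ⟨hom y hy, ext ?_⟩
    rw [LinearMap.comp_apply, hom_apply]
    exact hyφ
  · intro h z hz hz𝔞
    obtain ⟨ψ, hψ⟩ := h (hom z hz𝔞) (ext (by
      rw [LinearMap.comp_apply, hom_apply]
      exact hz))
    refine ⟨_, tors ψ, ?_⟩
    have := LinearMap.congr_fun hψ (Submodule.Quotient.mk 1)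
    rwa [hom_apply] at this

/-- Nonzero maps from `R/𝔞` to a derived functor of a subfunctor of the identity, in terms of
cocycles in an injective resolution. -/
theorem nontrivial_hom_rightDerived_iff (𝔞 : Ideal R)
    (T : ∀ X : ModuleCat.{u} R, Submodule R X)
    (hT : ∀ (X Y : ModuleCat.{u} R) (f : X →ₗ[R] Y), ∀ x ∈ T X, f x ∈ T Y)
    {M : ModuleCat.{u} R} (P : InjectiveResolution M) (t : ℕ) :
    Nontrivial ((R ⧸ 𝔞) →ₗ[R] ((subfunctor T hT).rightDerived t).obj M) ↔
      ∃ z : P.cocomplex.X t, z ∈ T _ ∧ P.cocomplex.d t ((ComplexShape.up ℕ).next t) z = 0 ∧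
        (∀ r ∈ 𝔞, ∃ y ∈ T _, P.cocomplex.d ((ComplexShape.up ℕ).prev t) t y = r • z) ∧
        ¬ ∃ y ∈ T _, P.cocomplex.d ((ComplexShape.up ℕ).prev t) t y = z := by
  let e := (P.isoRightDerivedObj (subfunctor T hT) t).toLinearEquiv
  rw [(e.congrRight (R := R) (M := R ⧸ 𝔞)).toEquiv.nontrivial_congr]
  refine (nontrivial_hom_homology_iff 𝔞
    (((subfunctor T hT).mapHomologicalComplex _).obj P.cocomplex) t).trans ?_
  have key : ∀ z : T (P.cocomplex.X t),
      (∃ y, (((subfunctor T hT).mapHomologicalComplex _).obj P.cocomplex).d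
        ((ComplexShape.up ℕ).prev t) t y = z) ↔
      ∃ y ∈ T _, P.cocomplex.d ((ComplexShape.up ℕ).prev t) t y = z := fun z =>
    ⟨fun ⟨y, hy⟩ => ⟨y.1, y.2, congrArg Subtype.val hy⟩,
      fun ⟨y, hyT, hy⟩ => ⟨⟨y, hyT⟩, Subtype.ext hy⟩⟩
  constructor
  · rintro ⟨z, hz, hr, hz0⟩
    exact ⟨z.1, z.2, congrArg Subtype.val hz, fun r hr' => (key (r • z)).1 (hr r hr'),
      fun h => hz0 ((key z).2 h)⟩
  · rintro ⟨z, hzT, hz, hr, hz0⟩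
    exact ⟨⟨z, hzT⟩, Subtype.ext hz, fun r hr' => (key (r • ⟨z, hzT⟩)).2 (hr r hr'),
      fun h => hz0 ((key ⟨z, hzT⟩).1 h)⟩

/-- Let `T` be the torsion functor attached to a filter `W` of ideals, such that
`Ext^i(N, M) = 0` for all `i < t` and all finite modules `N` annihilated by an ideal in `W`.
Then `Hom(R/𝔞, R^t T(M))` and `Ext^t(R/𝔞, M)` are simultaneously nonzero, for `𝔞 ∈ W`. -/
theorem nontrivial_hom_rightDerived_iff_ext [IsNoetherianRing R] {W : Set (Ideal R)}
    (hW : IsIdealFilter W) (T : ∀ X : ModuleCat.{u} R, Submodule R X)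
    (hT : ∀ (X Y : ModuleCat.{u} R) (f : X →ₗ[R] Y), ∀ x ∈ T X, f x ∈ T Y)
    (hTW : ∀ (X : ModuleCat.{u} R) (x : X), x ∈ T X ↔ Ideal.torsionOf R X x ∈ W)
    {𝔞 : Ideal R} (h𝔞 : 𝔞 ∈ W) (M : ModuleCat.{u} R) {t : ℕ}
    (hext : ∀ (N : Type u) [AddCommGroup N] [Module R N] [Module.Finite R N],
      Module.annihilator R N ∈ W → ∀ i < t, Subsingleton (Ext.{u} (ModuleCat.of R N) M i)) :
    Nontrivial ((R ⧸ 𝔞) →ₗ[R] ((subfunctor T hT).rightDerived t).obj M) ↔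
      Nontrivial (Ext.{u} (ModuleCat.of R (R ⧸ 𝔞)) M t) := by
  obtain ⟨P⟩ := HasInjectiveResolution.out (Z := M)
  have hinj (i : ℕ) : Module.Injective R (P.cocomplex.X i) :=
    have : Injective (ModuleCat.of R (P.cocomplex.X i)) := P.injective i
    Module.injective_module_of_injective_object _ _
  rw [nontrivial_hom_rightDerived_iff 𝔞 T hT P, nontrivial_ext_quotient_iff 𝔞 P]
  simp only [hTW]
  cases t with
  | zero =>
    have hshape : P.cocomplex.d ((ComplexShape.up ℕ).prev 0) 0 = 0 :=
      P.cocomplex.shape _ _ (by simp)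
    simp only [hshape]
    constructor
    · rintro ⟨z, -, hz, hr, hz0⟩
      refine ⟨z, hz, fun r hr' => ?_, fun ⟨y, _, hy⟩ => hz0 ⟨0, ?_, ?_⟩⟩
      · obtain ⟨y, -, hy⟩ := hr r hr'
        exact hy.symm
      · simpa using hW.top_mem
      · rw [← hy]; simp
    · rintro ⟨z, hz, hr, hz0⟩
      refine ⟨z, hW.mem_of_le h𝔞 hr, hz, fun r hr' => ⟨0, by simpa using hW.top_mem, ?_⟩,
        fun ⟨y, _, hy⟩ => hz0 ⟨0, by simp, ?_⟩⟩
      · rw [show r • z = 0 from hr hr']; simp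
      · rw [← hy]; simp
  | succ s =>
    -- Only the vanishing in degree `s = t - 1` is used.
    have hex : ExactOn W (P.cocomplex.d ((ComplexShape.up ℕ).prev s) s).hom
        (P.cocomplex.d s (s + 1)).hom := fun N _ _ _ hN φ hφ =>
      (subsingleton_ext_iff (ModuleCat.of R N) P s).1 (hext N hN s s.lt_succ_self) φ
        (by rwa [CochainComplex.next])
    have hd : (P.cocomplex.d s (s + 1)).hom ∘ₗ
        (P.cocomplex.d ((ComplexShape.up ℕ).prev s) s).hom = 0 := by
      rw [← ModuleCat.hom_comp, P.cocomplex.d_comp_d]; rfl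
    rw [CochainComplex.prev_nat_succ, CochainComplex.next]
    constructor
    · rintro ⟨z, hzW, hz, hr, hz0⟩
      obtain ⟨y, hyW, hy⟩ := exists_cohomologous_torsionBy hW hd hex hzW hr
      -- If `z - dy = dw` with `𝔞w = 0`, then `z = d(y + w)`, and `y + w` is `W`-torsion.
      refine ⟨z - P.cocomplex.d s (s + 1) y, ?_, hy, fun ⟨w, hw𝔞, hw⟩ => hz0 ⟨y + w, ?_, ?_⟩⟩
      · rw [map_sub, hz, ← ModuleCat.comp_apply, P.cocomplex.d_comp_d]
        simp
      · refine hW.mem_of_le (hW.inf_mem hyW (hW.mem_of_le h𝔞 hw𝔞)) fun r hr => ?_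
        have h1 : r • y = 0 := hr.1
        have h2 : r • w = 0 := hr.2
        change r • (y + w) = 0
        rw [smul_add, h1, h2, add_zero]
      · rw [map_add, hw]; abel
    · rintro ⟨z, hz, hz𝔞, hz0⟩
      refine ⟨z, hW.mem_of_le h𝔞 hz𝔞, hz, fun r hr => ⟨0, by simpa using hW.top_mem, ?_⟩, ?_⟩
      · rw [show r • z = 0 from hz𝔞 hr, map_zero]
      · rintro ⟨y, hyW, rfl⟩
        exact hz0 (exists_torsionBy_of_coboundary hW hd hex hyW hz𝔞)

end Homology

/-! ### The filters `W̃(I, J)` -/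

section Main

variable {R : Type u} [CommRing R]

theorem isIdealFilter_tildeW (I J : Ideal R) : IsIdealFilter (tildeW I J) where
  top_mem := ⟨0, by simp⟩
  inf_mem := by
    rintro 𝔟 𝔠 ⟨n, hn⟩ ⟨m, hm⟩
    refine ⟨n + m, ?_⟩
    rw [pow_add]
    refine (Ideal.mul_mono hn hm).trans ?_
    rw [Ideal.sup_mul, Ideal.mul_sup]
    exact sup_le (sup_le (le_trans Ideal.mul_le_inf le_sup_left)
      (Ideal.mul_le_right.trans le_sup_right)) (Ideal.mul_le_left.trans le_sup_right)
  mem_of_le := fun ⟨n, hn⟩ h => ⟨n, hn.trans (sup_le_sup_right h J)⟩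

theorem self_mem_tildeW (𝔞 J : Ideal R) : 𝔞 ∈ tildeW 𝔞 J :=
  ⟨1, by simp⟩

theorem tildeW_bot_subset (𝔞 J : Ideal R) : tildeW 𝔞 ⊥ ⊆ tildeW 𝔞 J :=
  fun _ ⟨n, hn⟩ => ⟨n, hn.trans (sup_le_sup_left bot_le _)⟩

theorem tildeW_subset {I J 𝔞 : Ideal R} (h : 𝔞 ∈ tildeW I J) : tildeW 𝔞 J ⊆ tildeW I J := by
  rintro 𝔠 ⟨m, hm⟩
  obtain ⟨n, hn⟩ := h
  -- `(𝔞 + J)^(m+1) ⊆ 𝔞^m + J`: the extra factor ensures that each remaining term contains a factor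
  -- from `J`.
  refine ⟨n * (m + 1), ?_⟩
  rw [pow_mul]
  refine (Ideal.pow_right_mono hn _).trans (Ideal.sup_pow_add_le_pow_sup_pow.trans ?_)
  rw [pow_one]
  exact sup_le hm le_sup_right

theorem mem_torsion_iff (𝔞 : Ideal R) {M : Type u} [AddCommGroup M] [Module R M] (x : M) :
    x ∈ torsion 𝔞 M ↔ Ideal.torsionOf R M x ∈ tildeW 𝔞 ⊥ := by
  simp only [tildeW, sup_bot_eq]
  rfl

theorem mem_pairTorsion_iff (I J : Ideal R) {M : Type u} [AddCommGroup M] [Module R M] (x : M) :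
    x ∈ pairTorsion I J M ↔ Ideal.torsionOf R M x ∈ tildeW I J :=
  exists_congr fun _ => smul_span_le_iff _ _ _

end Main

end PairDepth
/-- The number `t = depth(I, J, M)` is finite, because `𝔞 ∈ W̃(I, J)` and `𝔞M ≠ M`; this is
part of the claim. -/
theorem theorem3p7 {R : Type u} [CommRing R] [IsNoetherianRing R] (I J : Ideal R)
    (M : Type u) [AddCommGroup M] [Module R M] [Module.Finite R M]
    (𝔞 : Ideal R) (h𝔞 : 𝔞 ∈ PairDepth.tildeW I J)
    (hM : 𝔞 • (⊤ : Submodule R M) ≠ ⊤) :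
    ∃ t : ℕ, PairDepth.pairDepth I J M = (t : ℕ∞) ∧
      List.TFAE [
        Nontrivial ((R ⧸ 𝔞) →ₗ[R] PairDepth.H 𝔞 t M),
        Nontrivial ((R ⧸ 𝔞) →ₗ[R] PairDepth.pairH 𝔞 J t M),
        Nontrivial (Abelian.Ext.{u} (ModuleCat.of R (R ⧸ 𝔞)) (ModuleCat.of R M) t),
        Nontrivial ((R ⧸ 𝔞) →ₗ[R] PairDepth.pairH I J t M),
        PairDepth.depth 𝔞 M = (t : ℕ∞)] := by
  have hle : ∀ 𝔠 ∈ PairDepth.tildeW I J, PairDepth.pairDepth I J M ≤ PairDepth.depth 𝔠 M :=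
    fun 𝔠 h𝔠 => iInf₂_le 𝔠 h𝔠
  obtain ⟨t, ht⟩ := ENat.ne_top_iff_exists.1
    ((hle 𝔞 h𝔞).trans_lt (PairDepth.depth_lt_top hM)).ne
  refine ⟨t, ht.symm, ?_⟩
  have hext : ∀ (N : Type u) [AddCommGroup N] [Module R N] [Module.Finite R N],
      Module.annihilator R N ∈ PairDepth.tildeW I J → ∀ i < t,
      Subsingleton (Abelian.Ext.{u} (ModuleCat.of R N) (ModuleCat.of R M) i) :=
    fun N _ _ _ hN i hi =>
      PairDepth.subsingleton_ext_of_le_depth (ht.trans_le (hle _ hN)) N le_rfl hi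
  have hsub := PairDepth.tildeW_subset h𝔞
  have hbot := PairDepth.tildeW_bot_subset 𝔞 J
  -- The two smaller filters inherit the vanishing from `W̃(I, J)`.
  tfae_have 1 ↔ 3 := PairDepth.nontrivial_hom_rightDerived_iff_ext
    (PairDepth.isIdealFilter_tildeW 𝔞 ⊥) _ _ (fun _ => PairDepth.mem_torsion_iff 𝔞)
    (PairDepth.self_mem_tildeW 𝔞 ⊥) _ fun N _ _ _ hN => hext N (hsub (hbot hN))
  tfae_have 2 ↔ 3 := PairDepth.nontrivial_hom_rightDerived_iff_ext
    (PairDepth.isIdealFilter_tildeW 𝔞 J) _ _ (fun _ => PairDepth.mem_pairTorsion_iff 𝔞 J)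
    (PairDepth.self_mem_tildeW 𝔞 J) _ fun N _ _ _ hN => hext N (hsub hN)
  tfae_have 4 ↔ 3 := PairDepth.nontrivial_hom_rightDerived_iff_ext
    (PairDepth.isIdealFilter_tildeW I J) _ _ (fun _ => PairDepth.mem_pairTorsion_iff I J)
    h𝔞 _ hext
  tfae_have 3 ↔ 5 := PairDepth.nontrivial_ext_iff_depth_eq hM (ht.trans_le (hle 𝔞 h𝔞))
  tfae_finish
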